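/- Let $q,t\in\mathbb C$ with $0<|q|<1$, $t\neq 0$. Write $(x;q)_n=\prod_{i=0}^{n-1}(1-xq^i)$, $(x;q)_\infty=\prod_{i\ge 0}(1-xq^i)$, $(x_1,\dots,x_n;q)_k=\prod_i (x_i;q)_k$ (for $k\in\mathbb N_0\cup\{\infty\}$), $\Omega_q=\{q^{-k}:k=0,1,2,\dots\}$, and $${}_{r+1}\phi_s\!\left({\alpha_1,\dots,\alpha_{r+1}\atop \beta_1,\dots,\beta_s};q,z\right)=\sum_{k\ge 0}\frac{(\alpha_1,\dots,\alpha_{r+1};q)_k}{(q,\beta_1,\dots,\beta_s;q)_k}\Bigl((-1)^kq^{\binom k2}\Bigr)^{s-r}z^k .$$ For $p\ge 0$, ${}_{r+1}\phi_s^{p}$ (resp. ${}_{r+1}\phi_s^{-p}$) denotes the series obtained by adjoining $p$ lower (resp. upper) parameters equal to $0$, so that it is a ${}_{r+1}\phi_{s+p}$ (resp. ${}_{r+1+p}\phi_s$). (1) Let $\mathbf a=(a_1,\dots,a_A)$, $\mathbf b=(b_1,\dots,b_B)$, $\mathbf c=(c_1,\dots,c_C)$, $\mathbf d=(d_1,\dots,d_D)$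 be finite (possibly empty) families of nonzero complex numbers. Let $\mathbf c_{[k]}$, $\mathbf d_{[k]}$ be $\mathbf c$, $\mathbf d$ without their $k$-th entry; operations on families are entrywise. Suppose $c_k/c_{k'}\notin\Omega_q$ for $k\ne k'$, $d_l/d_{l'}\notin\Omega_q$ for $l\neq l'$, and $td_lc_k,\ td_la_i,\ tc_kb_j\notin\Omega_q$ for all $i,j,k,l$. Suppose further that either $B<D$, or $B=D$ and $|b_1\cdots b_B|<|d_1\cdots d_D|$; and that either $A<C$, or $A=C$ and $|a_1\cdots a_A|<|c_1\cdots c_C|$. Then all the series below converge absolutely and $$\sum_{k=1}^D\frac{(td_k\mathbf a,\mathbf b/d_k;q)_\infty}{(td_k\mathbf c,\mathbf d_{[k]}/d_k;q)_\infty}\;{}_{B+C}\phi_{A+D-1}^{\,C-A}\!\left({td_k\mathbf c,\ qd_k/\mathbf b\atop td_k\mathbf a,\ qd_k/\mathbf d_{[k]}};q,(qd_k)^{D-B}\frac{b_1\cdots b_B}{d_1\cdots d_D}\right)$$ $$=\sum_{k=1}^C\frac{(tc_k\mathbf b,\mathbf a/c_k;q)_\infty}{(tc_k\mathbf d,\mathbf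 c_{[k]}/c_k;q)_\infty}\;{}_{A+D}\phi_{B+C-1}^{\,D-B}\!\left({tc_k\mathbf d,\ qc_k/\mathbf a\atop tc_k\mathbf b,\ qc_k/\mathbf c_{[k]}};q,(qc_k)^{C-A}\frac{a_1\cdots a_A}{c_1\cdots c_C}\right).$$ (2) In particular ($A=B=C=D=2$), let $a,b,c,d,e,f,g,h$ be nonzero complex numbers with $|ab|<|ef|$ and $|cd|<|gh|$, such that $e/f,f/e,g/h,h/g\notin\Omega_q$, $xty\notin\Omega_q$ for $x\in\{e,f\}$, $y\in\{g,h,c,d\}$, and $xty\notin\Omega_q$ for $x\in\{g,h\}$, $y\in\{a,b\}$. Then the series below converge absolutely and $$\frac{(etc,etd,\frac ae,\frac be;q)_\infty}{(etg,eth,\frac fe;q)_\infty}\;{}_4\phi_3\!\left({etg,eth,\frac{qe}a,\frac{qe}b\atop etc,etd,\frac{qe}f};q,\frac{ab}{ef}\right)+\mathrm{idem}(e;f)$$ $$=\frac{(gta,gtb,\frac cg,\frac dg;q)_\infty}{(gte,gtf,\frac hg;q)_\infty}\;{}_4\phi_3\!\left({gte,gtf,\frac{qg}c,\frac{qg}d\atop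 gta,gtb,\frac{qg}h};q,\frac{cd}{gh}\right)+\mathrm{idem}(g;h),$$ where $\mathrm{idem}(x;y)$ stands for the preceding expression with $x$ and $y$ interchanged. -/

import Mathlib

open scoped BigOperators

noncomputable section

/-- The set `Ω_q = {q^{-k} : k = 0, 1, 2, …}`. -/
def OmegaQ (q : ℂ) : Set ℂ := {x | ∃ k : ℕ, x = (q ^ k)⁻¹}

/-- The finite `q`-shifted factorial `(a;q)_n = (1-a)(1-aq)⋯(1-aq^{n-1})`. -/
def qPoch (a q : ℂ) (n : ℕ) : ℂ := ∏ i ∈ Finset.range n, (1 - a * q ^ i)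

/-- The infinite `q`-shifted factorial `(a;q)_∞ = ∏_{n ≥ 0} (1-aq^n)`. -/
def qPochInf (a q : ℂ) : ℂ := ∏' n : ℕ, (1 - a * q ^ n)

/-- The `k`-th term of the basic hypergeometric series with upper parameters `α` (there are `r+1`
of them) and lower parameters `β` (there are `s` of them):
`(α;q)_k / ((q;q)_k (β;q)_k) * ((-1)^k q^{k(k-1)/2})^{s-r} * z^k`. -/
def phiTerm {ι κ : Type*} [Fintype ι] [Fintype κ] (α : ι → ℂ) (β : κ → ℂ) (q z : ℂ) (k : ℕ) : ℂ :=
  (∏ i, qPoch (α i) q k) / (qPoch q q k * ∏ j, qPoch (β j) q k) *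
    ((-1) ^ k * q ^ (k.choose 2)) ^ ((Fintype.card κ : ℤ) - ((Fintype.card ι : ℤ) - 1)) * z ^ k

/-- The basic hypergeometric series `_{r+1}φ_s(α; β; q, z)`. -/
def phi {ι κ : Type*} [Fintype ι] [Fintype κ] (α : ι → ℂ) (β : κ → ℂ) (q z : ℂ) : ℂ :=
  ∑' k : ℕ, phiTerm α β q z k

/-- The family `α` followed by `p` zeros. -/
def padZero {ι : Type*} (α : ι → ℂ) (p : ℕ) : ι ⊕ Fin p → ℂ := Sum.elim α (fun _ => 0)

/-- The `k`-th term of the van de Bult–Rains series `_{r+1}φ_s^m`: for `m = -p ≤ 0`, `p` zeros are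
adjoined to the upper parameters; for `m = p ≥ 0`, `p` zeros are adjoined to the lower ones. -/
def phiVBRTerm {ι κ : Type*} [Fintype ι] [Fintype κ] (m : ℤ) (α : ι → ℂ) (β : κ → ℂ)
    (q z : ℂ) (k : ℕ) : ℂ :=
  phiTerm (padZero α (-m).toNat) (padZero β m.toNat) q z k

/-- The van de Bult–Rains series `_{r+1}φ_s^m(α; β; q, z)`. -/
def phiVBR {ι κ : Type*} [Fintype ι] [Fintype κ] (m : ℤ) (α : ι → ℂ) (β : κ → ℂ) (q z : ℂ) : ℂ :=
  phi (padZero α (-m).toNat) (padZero β m.toNat) q z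

end

/-! Both sides are sums of residues of one function. For finite families with as many `α` as `γ` and
as many `β` as `δ`, the rational function `∏ (1 - β j x) ∏ (1 - t α i / x) / (x ∏ (1 - δ l x) ∏ (1 -
t γ k / x))` has simple poles at `1 / δ l`, at `t γ k` and possibly at `0` and `∞`. The vanishing of
its residue sum is `sum_pfResidue_add_eq`.

Replace every parameter `y` by the progression `y, y q, …, y q ^ (N - 1)`. The residue at `1 / (d l
* q ^ n)` is then `outerCoeff` at `n`, essentially the `n`-th term of the series with index `l`,
times factors that converge as `N → ∞` (`pfResidue_geometric`). The ratio test makes `outerCoeff`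
summable, so dominated convergence gives prefactor times series for each index
(`tendsto_sum_pfResidue`). The contributions of `∞` and `0` are the `N`-th powers of `∏ b / ∏ d` and
`∏ a / ∏ c`, which tend to `0`. This proves the balanced case `sum_outerPrefactor_mul_tsum_eq`.

There `a` and `b` may contain zeros. The cases `A < C` and `B < D` follow by padding with zeros, and
`phiVBRTerm_eq_outerCoeff` translates the coefficients into the stated series. -/

section

open Finset Filter Topology

/-! ### Residue theorem for a rational function, by Lagrange interpolation. -/

/-- Removing one index from a finite product amounts to replacing its factor by `1`. -/
theorem prod_erase_univ_eq_prod_ite {ι M : Type*} [Fintype ι] [DecidableEq ι] [CommMonoid M]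
    (f : ι → M) (i : ι) :
    ∏ j ∈ univ.erase i, f j = ∏ j, if j = i then 1 else f j := by
  rw [← Finset.mul_prod_erase univ (fun j => if j = i then (1 : M) else f j) (mem_univ i)]
  rw [if_pos rfl, one_mul]
  exact Finset.prod_congr rfl fun j hj => (if_neg (Finset.ne_of_mem_erase hj)).symm

/-- The negative of the residue at `x = 1 / δ l` of
`∏ (1 - β j x) ∏ (1 - t α i / x) / (x ∏ (1 - δ l x) ∏ (1 - t γ k / x))`. -/
noncomputable def pfResidue {I J K L : Type*} [Fintype I] [Fintype J] [Fintype K] [Fintype L]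
    [DecidableEq L] (t : ℂ) (α : I → ℂ) (β : J → ℂ) (γ : K → ℂ) (δ : L → ℂ) (l : L) : ℂ :=
  ((∏ j, (1 - β j / δ l)) * ∏ i, (1 - t * δ l * α i)) /
    ((∏ l', if l' = l then 1 else 1 - δ l' / δ l) * ∏ k, (1 - t * δ l * γ k))

/-- The sum of the residues of a rational function on the projective line vanishes. -/
theorem sum_pfResidue_add_eq {I J K L : Type*} [Fintype I] [Fintype J] [Fintype K] [Fintype L]
    [DecidableEq K] [DecidableEq L] {t : ℂ} (ht : t ≠ 0)
    (hIK : Fintype.card I = Fintype.card K) (hJL : Fintype.card J = Fintype.card L)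
    (α : I → ℂ) (β : J → ℂ) {γ : K → ℂ} {δ : L → ℂ} (hγ : ∀ k, γ k ≠ 0) (hδ : ∀ l, δ l ≠ 0)
    (hγi : Function.Injective γ) (hδi : Function.Injective δ)
    (hδγ : ∀ l k, t * δ l * γ k ≠ 1) :
    ∑ l, pfResidue t α β γ δ l + (∏ j, β j) / ∏ l, δ l =
      ∑ k, pfResidue t β α δ γ k + (∏ i, α i) / ∏ k, γ k := by
  -- The nodes are the finite poles `0`, `1 / δ l` and `t γ k`. Clearing the denominators `1 / x`,
  -- equally many above and below because `I` and `K` have the same size, turns the numerator into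
  -- the polynomial `P` below.
  set v : Option (L ⊕ K) → ℂ :=
    fun o => o.elim 0 (Sum.elim (fun l => (δ l)⁻¹) fun k => t * γ k) with hv
  have hvi : Function.Injective v := by
    rintro (_ | (l | k)) (_ | (l' | k')) h <;> simp only [hv, Option.elim, Sum.elim_inl,
      Sum.elim_inr] at h
    · rfl
    · exact absurd h.symm (inv_ne_zero (hδ l'))
    · exact absurd h.symm (mul_ne_zero ht (hγ k'))
    · exact absurd h (inv_ne_zero (hδ l))
    · rw [hδi (inv_injective h)]
    · refine absurd ?_ (hδγ l k')
      rw [mul_right_comm, ← h, inv_mul_cancel₀ (hδ l)]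
    · exact absurd h (mul_ne_zero ht (hγ k))
    · refine absurd ?_ (hδγ l' k)
      rw [mul_right_comm, h, inv_mul_cancel₀ (hδ l')]
    · rw [hγi (mul_left_cancel₀ ht h)]
  set P : Polynomial ℂ := (∏ j, (Polynomial.C (-β j) * Polynomial.X + Polynomial.C 1)) *
    ∏ i, (Polynomial.X - Polynomial.C (t * α i)) with hP
  have hd1 : (∏ j, (Polynomial.C (-β j) * Polynomial.X + Polynomial.C 1)).natDegree ≤
      Fintype.card J := by
    refine (Polynomial.natDegree_prod_le _ _).trans ?_
    refine (Finset.sum_le_sum fun j _ => Polynomial.natDegree_linear_le).trans ?_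
    simp
  have hmon : (∏ i, (Polynomial.X - Polynomial.C (t * α i))).Monic :=
    Polynomial.monic_prod_of_monic _ _ fun i _ => Polynomial.monic_X_sub_C _
  have hd2 : (∏ i, (Polynomial.X - Polynomial.C (t * α i))).natDegree = Fintype.card I := by
    rw [Polynomial.natDegree_prod_of_monic _ _ fun i _ => Polynomial.monic_X_sub_C _]
    simp only [Polynomial.natDegree_X_sub_C, Finset.sum_const, Finset.card_univ, smul_eq_mul,
      mul_one]
  have hcard : #(univ : Finset (Option (L ⊕ K))) = Fintype.card J + Fintype.card I + 1 := by
    simp [hIK, hJL]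
  -- There is one node more than the largest possible degree of `P`. Lagrange's formula therefore
  -- yields the coefficient in that degree, `∏ (-β j)`, which plays the role of the residue at
  -- infinity.
  have hdeg : P.degree < #(univ : Finset (Option (L ⊕ K))) := by
    refine Polynomial.degree_le_natDegree.trans_lt ?_
    rw [hcard]
    exact_mod_cast Nat.lt_succ_of_le
      ((Polynomial.natDegree_mul_le).trans (add_le_add hd1 hd2.le))
  have hcoeff : P.coeff (Fintype.card J + Fintype.card I) = ∏ j, (-β j) := by
    rw [hP, Polynomial.coeff_mul_add_eq_of_natDegree_le hd1 hd2.le]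
    have h1 : (∏ i, (Polynomial.X - Polynomial.C (t * α i))).coeff (Fintype.card I) = 1 := by
      rw [← hd2]; exact hmon
    have h2 := Polynomial.coeff_prod_of_natDegree_le (s := (univ : Finset J))
      (f := fun j => Polynomial.C (-β j) * Polynomial.X + Polynomial.C 1) 1
      fun j _ => Polynomial.natDegree_linear_le
    rw [mul_one, Finset.card_univ] at h2
    rw [h1, mul_one, h2]
    refine Finset.prod_congr rfl fun j _ => ?_
    rw [Polynomial.coeff_add, Polynomial.coeff_C_mul, Polynomial.coeff_X_one,
      Polynomial.coeff_C_succ, mul_one, add_zero]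
  have key := Lagrange.coeff_eq_sum (s := univ) (v := v) hvi.injOn hdeg
  rw [hcard, Nat.add_sub_cancel, hcoeff] at key
  have heval : ∀ x, P.eval x = (∏ j, (1 - β j * x)) * ∏ i, (x - t * α i) := by
    intro x
    simp only [hP, Polynomial.eval_mul, Polynomial.eval_prod]
    congr 1
    · refine Finset.prod_congr rfl fun j _ => ?_
      simp; ring
    · simp
  simp only [prod_erase_univ_eq_prod_ite, heval, Fintype.sum_option, Fintype.sum_sum_type,
    Fintype.prod_option, Fintype.prod_sum_type, hv, Option.elim, Sum.elim_inl, Sum.elim_inr,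
    Option.some.injEq, Sum.inl.injEq, Sum.inr.injEq, reduceCtorEq, if_true, if_false, one_mul]
    at key
  -- After the normalisations below every node contributes a multiple of `∏ (-δ l)`, with a minus
  -- sign at the nodes `1 / δ l` only. Dividing by this product gives the identity.
  have hδP : ∏ l, (-δ l) ≠ 0 := Finset.prod_ne_zero_iff.2 fun l _ => neg_ne_zero.2 (hδ l)
  have hγP : ∏ k, γ k ≠ 0 := Finset.prod_ne_zero_iff.2 fun k _ => hγ k
  have e0 : (∏ j, (1 - β j * 0)) * ∏ i, (0 - t * α i) = (-t) ^ Fintype.card K * ∏ i, α i := by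
    simp only [mul_zero, sub_zero, Finset.prod_const_one, one_mul, zero_sub, ← neg_mul,
      Finset.prod_mul_distrib, Finset.prod_const, Finset.card_univ, hIK]
  have e0' : (∏ l, (0 - (δ l)⁻¹)) * ∏ k, (0 - t * γ k) =
      (∏ l, (-δ l))⁻¹ * ((-t) ^ Fintype.card K * ∏ k, γ k) := by
    simp only [zero_sub, ← neg_mul, Finset.prod_mul_distrib, Finset.prod_const, Finset.card_univ,
      ← Finset.prod_inv_distrib, inv_neg]
  have e1 : ∀ l, ((∏ j, (1 - β j * (δ l)⁻¹)) * ∏ i, ((δ l)⁻¹ - t * α i)) /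
      (((δ l)⁻¹ - 0) * ((∏ l', if l' = l then 1 else (δ l)⁻¹ - (δ l')⁻¹) *
        ∏ k, ((δ l)⁻¹ - t * γ k))) = -(∏ l, (-δ l)) * pfResidue t α β γ δ l := by
    intro l
    have hl := hδ l
    have f1 : ∏ i, ((δ l)⁻¹ - t * α i) =
        (δ l)⁻¹ ^ Fintype.card K * ∏ i, (1 - t * δ l * α i) := by
      rw [← hIK, ← Finset.card_univ, ← Finset.prod_const, ← Finset.prod_mul_distrib]
      exact Finset.prod_congr rfl fun i _ => by field_simp
    have f2 : ∏ k, ((δ l)⁻¹ - t * γ k) =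
        (δ l)⁻¹ ^ Fintype.card K * ∏ i, (1 - t * δ l * γ i) := by
      rw [← Finset.card_univ, ← Finset.prod_const, ← Finset.prod_mul_distrib]
      exact Finset.prod_congr rfl fun i _ => by field_simp
    have f3 : (∏ l', if l' = l then 1 else (δ l)⁻¹ - (δ l')⁻¹) =
        (∏ l', -δ l')⁻¹ * (-δ l) * ∏ l', if l' = l then 1 else 1 - δ l' / δ l := by
      rw [eq_comm, mul_assoc, inv_mul_eq_iff_eq_mul₀ hδP,
        ← Finset.mul_prod_erase univ (fun l' => -δ l') (mem_univ l), mul_assoc,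
        prod_erase_univ_eq_prod_ite, ← Finset.prod_mul_distrib]
      congr 1
      refine Finset.prod_congr rfl fun l' _ => ?_
      split_ifs
      · simp
      · have := hδ l'
        field_simp
        ring
    rw [f1, f2, f3, pfResidue]
    have hpow : (δ l)⁻¹ ^ Fintype.card K ≠ 0 := pow_ne_zero _ (inv_ne_zero hl)
    simp only [← div_eq_mul_inv (β _)]
    generalize (δ l)⁻¹ ^ Fintype.card K = p at *
    generalize (∏ l', -δ l') = D at *
    generalize (∏ l', if l' = l then 1 else 1 - δ l' / δ l) = E
    generalize (∏ k, (1 - t * δ l * γ k)) = F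
    generalize (∏ i, (1 - t * δ l * α i)) = G
    generalize (∏ j, (1 - β j / δ l)) = H
    have : ((δ l)⁻¹ - 0) * (D⁻¹ * -δ l * E * (p * F)) = -(D⁻¹ * p) * (E * F) := by
      field_simp
      ring
    rw [this]
    have : H * (p * G) = -(D⁻¹ * p) * (-D * (H * G)) := by field_simp
    rw [this, mul_div_mul_left _ _ (neg_ne_zero.2 (mul_ne_zero (inv_ne_zero hδP) hpow)),
      mul_div_assoc]
  have e2 : ∀ k, ((∏ j, (1 - β j * (t * γ k))) * ∏ i, (t * γ k - t * α i)) /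
      ((t * γ k - 0) * ((∏ l, (t * γ k - (δ l)⁻¹)) *
        ∏ k', if k' = k then 1 else t * γ k - t * γ k')) =
      (∏ l, (-δ l)) * pfResidue t β α δ γ k := by
    intro k
    have hk := hγ k
    have f1 : ∏ i, (t * γ k - t * α i) =
        (t * γ k) ^ Fintype.card K * ∏ i, (1 - α i / γ k) := by
      rw [← hIK, ← Finset.card_univ, ← Finset.prod_const, ← Finset.prod_mul_distrib]
      exact Finset.prod_congr rfl fun i _ => by field_simp
    have f2 : (t * γ k) * (∏ k', if k' = k then 1 else t * γ k - t * γ k') =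
        (t * γ k) ^ Fintype.card K * ∏ k', if k' = k then 1 else 1 - γ k' / γ k := by
      rw [← Finset.card_univ, ← Finset.prod_const,
        ← Finset.mul_prod_erase univ (fun _ => t * γ k) (mem_univ k),
        mul_assoc (t * γ k), prod_erase_univ_eq_prod_ite, ← Finset.prod_mul_distrib]
      congr 1
      refine Finset.prod_congr rfl fun l' _ => ?_
      split_ifs
      · simp
      · field_simp
    have f3 : ∏ l, (t * γ k - (δ l)⁻¹) = (∏ l, -δ l)⁻¹ * ∏ l, (1 - t * γ k * δ l) := by
      rw [← Finset.prod_inv_distrib, ← Finset.prod_mul_distrib]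
      refine Finset.prod_congr rfl fun l _ => ?_
      have := hδ l
      field_simp
      ring
    have f4 : ∏ j, (1 - β j * (t * γ k)) = ∏ j, (1 - t * γ k * β j) :=
      Finset.prod_congr rfl fun j _ => by ring
    rw [sub_zero, mul_left_comm, f2, f1, f3, f4, pfResidue]
    have hpow : (t * γ k) ^ Fintype.card K ≠ 0 := pow_ne_zero _ (mul_ne_zero ht hk)
    generalize (t * γ k) ^ Fintype.card K = p at *
    generalize (∏ l', -δ l') = D at *
    generalize (∏ k', if k' = k then 1 else 1 - γ k' / γ k) = E
    generalize (∏ l, (1 - t * γ k * δ l)) = F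
    generalize (∏ j, (1 - t * γ k * β j)) = G
    generalize (∏ i, (1 - α i / γ k)) = H
    have e5 : D⁻¹ * F * (p * E) = (D⁻¹ * p) * (E * F) := by ring
    have e6 : G * (p * H) = (D⁻¹ * p) * (D * (H * G)) := by field_simp
    rw [e5, e6, mul_div_mul_left _ _ (mul_ne_zero (inv_ne_zero hδP) hpow), mul_div_assoc]
  simp only [e1, e2] at key
  rw [e0, e0', ← Finset.mul_sum, ← Finset.mul_sum] at key
  have hβ : (∏ j, β j) / ∏ l, δ l = (∏ j, -β j) / ∏ l, -δ l := by
    simp only [Finset.prod_neg, Finset.card_univ, hJL]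
    rw [mul_div_mul_left _ _ (pow_ne_zero _ (by norm_num))]
  have ht' : (-t) ^ Fintype.card K ≠ 0 := pow_ne_zero _ (neg_ne_zero.2 ht)
  rw [hβ, key]
  field_simp
  ring

/-! ### Convergence and nonvanishing of `q`-shifted factorials. -/

theorem summable_norm_mul_pow {q : ℂ} (hq : ‖q‖ < 1) (x : ℂ) :
    Summable fun n : ℕ => ‖-(x * q ^ n)‖ := by
  simp only [norm_neg, norm_mul, norm_pow]
  exact (summable_geometric_of_lt_one (norm_nonneg _) hq).mul_left _

theorem tendsto_qPoch {q : ℂ} (hq : ‖q‖ < 1) (x : ℂ) :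
    Tendsto (qPoch x q) atTop (𝓝 (qPochInf x q)) := by
  have h := (multipliable_one_add_of_summable (summable_norm_mul_pow hq x)).hasProd.tendsto_prod_nat
  simp only [← sub_eq_add_neg] at h
  exact h

theorem one_sub_mul_pow_ne_zero {q x : ℂ} (hx : x ∉ OmegaQ q) (n : ℕ) :
    1 - x * q ^ n ≠ 0 := fun h =>
  hx ⟨n, eq_inv_of_mul_eq_one_left (sub_eq_zero.1 h).symm⟩

theorem qPoch_ne_zero {q x : ℂ} (hx : x ∉ OmegaQ q) (n : ℕ) : qPoch x q n ≠ 0 :=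
  Finset.prod_ne_zero_iff.2 fun i _ => one_sub_mul_pow_ne_zero hx i

theorem qPochInf_ne_zero {q x : ℂ} (hq : ‖q‖ < 1) (hx : x ∉ OmegaQ q) :
    qPochInf x q ≠ 0 := by
  have h := tprod_one_add_ne_zero_of_summable (f := fun n : ℕ => -(x * q ^ n))
    (fun n => by rw [← sub_eq_add_neg]; exact one_sub_mul_pow_ne_zero hx n)
    (summable_norm_mul_pow hq x)
  simp only [← sub_eq_add_neg] at h
  exact h

theorem not_mem_OmegaQ_of_norm_lt_one {q x : ℂ} (hq0 : q ≠ 0) (hq : ‖q‖ < 1) (hx : ‖x‖ < 1) :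
    x ∉ OmegaQ q := by
  rintro ⟨k, rfl⟩
  rw [norm_inv, norm_pow] at hx
  exact absurd hx (not_lt.2 ((one_le_inv₀ (pow_pos (norm_pos_iff.2 hq0) k)).2
    (pow_le_one₀ (norm_nonneg _) hq.le)))

/-- Both `x` and its inverse must avoid `OmegaQ q`, since `n - m` can have either sign. -/
theorem mul_pow_ne_pow_of_not_mem_OmegaQ {q x : ℂ} (hq0 : q ≠ 0) (hx : x ∉ OmegaQ q)
    (hx' : x⁻¹ ∉ OmegaQ q) (m n : ℕ) : x * q ^ m ≠ q ^ n := by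
  intro h
  rcases le_total n m with hnm | hnm
  · obtain ⟨k, rfl⟩ := Nat.exists_eq_add_of_le hnm
    refine hx ⟨k, eq_inv_of_mul_eq_one_left ?_⟩
    refine mul_right_cancel₀ (pow_ne_zero n hq0) ?_
    linear_combination h
  · obtain ⟨k, rfl⟩ := Nat.exists_eq_add_of_le hnm
    refine hx' ⟨k, ?_⟩
    rw [inv_inj]
    refine mul_right_cancel₀ (pow_ne_zero m hq0) ?_
    linear_combination h

/-! ### Finite products along a truncated geometric progression. -/

theorem qPoch_add (x q : ℂ) (n m : ℕ) :
    qPoch x q (n + m) = qPoch x q n * qPoch (x * q ^ n) q m := by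
  simp only [qPoch, Finset.prod_range_add, pow_add, mul_assoc]

/-- The product `(q - x)(q² - x)⋯(qⁿ - x)`, a form of `(q / x; q)_n` that makes sense at `x = 0`. -/
noncomputable def qGap (x q : ℂ) (n : ℕ) : ℂ := ∏ i ∈ range n, (q ^ (i + 1) - x)

theorem qGap_eq {x q : ℂ} (hx : x ≠ 0) (n : ℕ) : qGap x q n = (-x) ^ n * qPoch (q / x) q n := by
  rw [qGap, qPoch, ← Finset.card_range n, ← Finset.prod_const, Finset.card_range,
    ← Finset.prod_mul_distrib]
  refine Finset.prod_congr rfl fun i _ => ?_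
  field_simp
  ring

/-- A vanishing numerator parameter contributes this factor; it is the source of the power `q ^
(n.choose 2)` and of the powers of `q` in the argument of the series. -/
theorem qGap_zero_eq (q : ℂ) (n : ℕ) : qGap 0 q n = q ^ n.choose 2 * q ^ n := by
  induction n with
  | zero => simp [qGap]
  | succ n ih =>
    rw [qGap, Finset.prod_range_succ, ← qGap, ih, Nat.choose_succ_succ' n 1, Nat.choose_one_right]
    ring

/-- Shifting the base point of a `q`-shifted factorial downwards. -/
theorem prod_one_sub_div_pow {q : ℂ} (hq0 : q ≠ 0) (x : ℂ) (n M : ℕ) :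
    ∏ m ∈ range (n + M), (1 - x * q ^ m / q ^ n) =
      qGap x q n / qGap 0 q n * qPoch x q M := by
  rw [Finset.prod_range_add]
  congr 1
  · rw [qGap, qGap, ← Finset.prod_div_distrib, ← Finset.prod_range_reflect]
    refine Finset.prod_congr rfl fun i hi => ?_
    have hi' : n = n - 1 - i + (i + 1) := by have := Finset.mem_range.1 hi; omega
    have : q ^ n = q ^ (n - 1 - i) * q ^ (i + 1) := by rw [← pow_add, ← hi']
    rw [this, sub_zero]
    have := pow_ne_zero (n - 1 - i) hq0
    have := pow_ne_zero (i + 1) hq0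
    field_simp
  · rw [qPoch]
    refine Finset.prod_congr rfl fun i _ => ?_
    have := pow_ne_zero n hq0
    rw [pow_add]
    field_simp

/-- This is the progression containing the pole itself. The omitted factor `m = n` would vanish, so
the remaining tail starts at `q` and has `M` factors, not `M + 1`. -/
theorem prod_ite_one_sub_div_pow {q : ℂ} (hq0 : q ≠ 0) (n M : ℕ) :
    ∏ m ∈ range (n + (M + 1)), (if m = n then 1 else 1 - q ^ m / q ^ n) =
      qGap 1 q n / qGap 0 q n * qPoch q q M := by
  rw [Finset.prod_range_add, Finset.prod_range_succ']
  have h1 : ∏ m ∈ range n, (if m = n then 1 else 1 - q ^ m / q ^ n) =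
      qGap 1 q n / qGap 0 q n := by
    have h := prod_one_sub_div_pow hq0 1 n 0
    simp only [one_mul, add_zero, qPoch, Finset.range_zero, Finset.prod_empty, mul_one] at h
    rw [← h]
    exact Finset.prod_congr rfl fun m hm => if_neg (Finset.mem_range.1 hm).ne
  rw [h1, add_zero, if_pos rfl, mul_one, qPoch]
  congr 1
  refine Finset.prod_congr rfl fun m _ => ?_
  have := pow_ne_zero n hq0
  rw [if_neg (by omega), pow_add]
  field_simp
  ring

/-! ### Coefficients of the series and their summability. -/

section
variable {I J K L : Type*} [Fintype I] [Fintype J] [Fintype K] [Fintype L]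

/-- The coefficients of the hypergeometric series attached to the index `l`, with the powers of
`q` and the argument absorbed in the factors `qGap`. -/
noncomputable def outerCoeff (q t : ℂ) (a : I → ℂ) (b : J → ℂ) (c : K → ℂ) (d : L → ℂ) (l : L)
    (n : ℕ) : ℂ :=
  ((∏ j, qGap (b j / d l) q n) * ∏ k, qPoch (t * d l * c k) q n) /
    ((∏ l', qGap (d l' / d l) q n) * ∏ i, qPoch (t * d l * a i) q n)

theorem tendsto_pow_succ_sub {q : ℂ} (hq : ‖q‖ < 1) (x : ℂ) :
    Tendsto (fun n : ℕ => q ^ (n + 1) - x) atTop (𝓝 (-x)) := by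
  have h := ((tendsto_pow_atTop_nhds_zero_of_norm_lt_one hq).comp
    (tendsto_add_atTop_nat 1)).sub_const x
  simpa using h

theorem tendsto_one_sub_mul_pow {q : ℂ} (hq : ‖q‖ < 1) (x : ℂ) :
    Tendsto (fun n : ℕ => 1 - x * q ^ n) atTop (𝓝 1) := by
  have h := ((tendsto_pow_atTop_nhds_zero_of_norm_lt_one hq).const_mul x).const_sub 1
  simpa using h

/-- The ratio test for `outerCoeff`. -/
theorem summable_norm_outerCoeff {q : ℂ} (hq : ‖q‖ < 1) (t : ℂ) (a : I → ℂ) (b : J → ℂ)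
    (c : K → ℂ) {d : L → ℂ} (hJL : Fintype.card J = Fintype.card L) (hd : ∀ l, d l ≠ 0)
    (hbd : ‖∏ j, b j‖ < ‖∏ l, d l‖) (l : L) :
    Summable fun n => ‖outerCoeff q t a b c d l n‖ := by
  set ρ : ℕ → ℂ := fun n =>
    ((∏ j, (q ^ (n + 1) - b j / d l)) * ∏ k, (1 - t * d l * c k * q ^ n)) /
      ((∏ l', (q ^ (n + 1) - d l' / d l)) * ∏ i, (1 - t * d l * a i * q ^ n)) with hρ
  -- With `x / 0 = 0` this recursion holds even if a denominator vanishes, so no condition on `t * d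
  -- l * a i` is required here.
  have hstep : ∀ n, outerCoeff q t a b c d l (n + 1) = ρ n * outerCoeff q t a b c d l n := by
    intro n
    simp only [outerCoeff, hρ, qGap, qPoch, Finset.prod_range_succ, Finset.prod_mul_distrib]
    rw [div_mul_div_comm]
    congr 1 <;> ring
  have hnz : ∏ l', -(d l' / d l) ≠ 0 :=
    Finset.prod_ne_zero_iff.2 fun l' _ => neg_ne_zero.2 (div_ne_zero (hd l') (hd l))
  -- The factors involving `t` tend to `1`. In the limit the powers of `d l` and the signs cancel,
  -- as `J` and `L` have the same size, leaving `∏ b / ∏ d`.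
  have hlim : Tendsto ρ atTop (𝓝 (((∏ j, -(b j / d l)) * ∏ _k : K, 1) /
      ((∏ l', -(d l' / d l)) * ∏ _i : I, 1))) := by
    refine Tendsto.div (Tendsto.mul ?_ ?_) (Tendsto.mul ?_ ?_) ?_
    · exact tendsto_finsetProd _ fun j _ => tendsto_pow_succ_sub hq _
    · exact tendsto_finsetProd _ fun j _ => tendsto_one_sub_mul_pow hq _
    · exact tendsto_finsetProd _ fun j _ => tendsto_pow_succ_sub hq _
    · exact tendsto_finsetProd _ fun j _ => tendsto_one_sub_mul_pow hq _
    · simpa using hnz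
  have hlt : ‖((∏ j, -(b j / d l)) * ∏ _k : K, (1 : ℂ)) /
      ((∏ l', -(d l' / d l)) * ∏ _i : I, 1)‖ < 1 := by
    have hpos : 0 < ‖∏ l, d l‖ := (norm_nonneg _).trans_lt hbd
    have hl : (0 : ℝ) < ‖d l‖ ^ Fintype.card L := pow_pos (norm_pos_iff.2 (hd l)) _
    simp only [Finset.prod_const_one, mul_one, norm_div, norm_prod, norm_neg,
      Finset.prod_div_distrib, Finset.prod_const, Finset.card_univ, hJL] at hbd hpos ⊢
    rw [div_div_div_cancel_right₀ hl.ne', div_lt_one hpos]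
    exact hbd
  obtain ⟨r, hr1, hr2⟩ := exists_between hlt
  refine summable_of_ratio_norm_eventually_le hr2 ?_
  filter_upwards [hlim.norm.eventually (gt_mem_nhds hr1)] with n hn
  rw [norm_norm, norm_norm, hstep, norm_mul]
  exact mul_le_mul_of_nonneg_right (le_of_lt hn) (norm_nonneg _)

end

/-! ### Residues for geometric families and the limit `N → ∞`. -/

section
variable {I J K L : Type*} [Fintype I] [Fintype J] [Fintype K] [Fintype L]

/-- The ratio between the truncated and the full coefficients in the variable `t d a`, `t d c`. -/
noncomputable def upperFactor (q t : ℂ) (a : I → ℂ) (c : K → ℂ) (x : ℂ) (m : ℕ) : ℂ :=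
  (∏ i, qPoch (t * x * a i) q m) / ∏ k, qPoch (t * x * c k) q m

/-- The product of `(b / d l; q)_m` over the product of `(d l' / d l; q)_m` with `l' ≠ l`. -/
noncomputable def lowerFactor [DecidableEq L] (q : ℂ) (b : J → ℂ) (d : L → ℂ) (l : L) (m : ℕ) : ℂ :=
  (∏ j, qPoch (b j / d l) q m) / ∏ l' : {l' // l' ≠ l}, qPoch (d l' / d l) q m

theorem prod_prod_geometric {q : ℂ} (f : I → ℂ) (g : ℂ → ℂ) (N : ℕ) :
    ∏ p : I × Fin N, g (f p.1 * q ^ (p.2 : ℕ)) = ∏ i, ∏ m ∈ range N, g (f i * q ^ m) := by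
  rw [Fintype.prod_prod_type]
  exact Finset.prod_congr rfl fun i _ =>
    (Finset.prod_range fun m => g (f i * q ^ m)).symm

theorem prod_ite_eq_mul_prod_subtype_ne [DecidableEq L] (f g : L → ℂ) (l : L) :
    ∏ l', (if l' = l then g l' else f l') = g l * ∏ l' : {l' // l' ≠ l}, f l' := by
  rw [Fintype.prod_eq_mul_prod_subtype_ne _ l, if_pos rfl]
  congr 1
  exact Finset.prod_congr rfl fun l' _ => if_neg l'.2

theorem prod_one_sub_mul_geometric {q t x : ℂ} (a : I → ℂ)
    (ha : ∀ i, t * x * a i ∉ OmegaQ q) (n N : ℕ) :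
    ∏ p : I × Fin N, (1 - t * (x * q ^ n) * (a p.1 * q ^ (p.2 : ℕ))) =
      (∏ i, qPoch (t * x * a i) q (n + N)) / ∏ i, qPoch (t * x * a i) q n := by
  rw [prod_prod_geometric a (fun y => 1 - t * (x * q ^ n) * y), ← Finset.prod_div_distrib]
  refine Finset.prod_congr rfl fun i _ => ?_
  rw [qPoch_add, mul_div_cancel_left₀ _ (qPoch_ne_zero (ha i) n), qPoch]
  exact Finset.prod_congr rfl fun m _ => by ring

/-- The residues for geometric families of zeros and poles. -/
theorem pfResidue_geometric [DecidableEq L] {q t : ℂ} (hq0 : q ≠ 0)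
    (a : I → ℂ) (b : J → ℂ) (c : K → ℂ) {d : L → ℂ}
    (hJL : Fintype.card J = Fintype.card L) (hd : ∀ l, d l ≠ 0)
    (hda : ∀ l i, t * d l * a i ∉ OmegaQ q) (hdc : ∀ l k, t * d l * c k ∉ OmegaQ q)
    (l : L) (n M : ℕ) (hn : n < n + (M + 1)) :
    pfResidue t (fun p : I × Fin (n + (M + 1)) => a p.1 * q ^ (p.2 : ℕ))
      (fun p : J × Fin (n + (M + 1)) => b p.1 * q ^ (p.2 : ℕ))
      (fun p : K × Fin (n + (M + 1)) => c p.1 * q ^ (p.2 : ℕ))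
      (fun p : L × Fin (n + (M + 1)) => d p.1 * q ^ (p.2 : ℕ)) (l, ⟨n, hn⟩) =
    outerCoeff q t a b c d l n *
      (upperFactor q t a c (d l) (n + (n + (M + 1))) * lowerFactor q b d l (M + 1) *
        (qPoch q q M)⁻¹) := by
  have hl := hd l
  have hqn := pow_ne_zero n hq0
  have hg0 : qGap 0 q n ≠ 0 := Finset.prod_ne_zero_iff.2 fun i _ => by
    rw [sub_zero]; exact pow_ne_zero _ hq0
  -- The truncation length is `N = n + (M + 1)`. The power of `qGap 0 q n` occurs here and in `hdd`
  -- with the same exponent, because `J` and `L` have the same size, and cancels.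
  have hb : ∏ p : J × Fin (n + (M + 1)), (1 - b p.1 * q ^ (p.2 : ℕ) / (d l * q ^ n)) =
      (∏ j, qGap (b j / d l) q n) / qGap 0 q n ^ Fintype.card L *
        ∏ j, qPoch (b j / d l) q (M + 1) := by
    rw [prod_prod_geometric b (fun y => 1 - y / (d l * q ^ n)), ← hJL, ← Finset.card_univ,
      ← Finset.prod_const, ← Finset.prod_div_distrib, ← Finset.prod_mul_distrib]
    refine Finset.prod_congr rfl fun j _ => ?_
    rw [← prod_one_sub_div_pow hq0]
    exact Finset.prod_congr rfl fun i _ => by field_simp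
  have hdd : (∏ p : L × Fin (n + (M + 1)), if p = (l, ⟨n, hn⟩) then 1 else
        1 - d p.1 * q ^ (p.2 : ℕ) / (d l * q ^ n)) =
      (∏ l', qGap (d l' / d l) q n) / qGap 0 q n ^ Fintype.card L *
        ((∏ l' : {l' // l' ≠ l}, qPoch (d l' / d l) q (M + 1)) * qPoch q q M) := by
    rw [mul_comm (∏ l' : {l' // l' ≠ l}, _),
      ← prod_ite_eq_mul_prod_subtype_ne (fun l' => qPoch (d l' / d l) q (M + 1))
        (fun _ => qPoch q q M) l, Fintype.prod_prod_type, ← Finset.card_univ,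
      ← Finset.prod_const, ← Finset.prod_div_distrib, ← Finset.prod_mul_distrib]
    refine Finset.prod_congr rfl fun l' _ => ?_
    by_cases h : l' = l
    · subst h
      rw [if_pos rfl, div_self hl, ← prod_ite_one_sub_div_pow hq0, Finset.prod_range]
      refine Finset.prod_congr rfl fun m _ => ?_
      simp only [Prod.mk.injEq, true_and, Fin.ext_iff]
      rw [mul_div_mul_left _ _ hl]
    · rw [if_neg h, ← prod_one_sub_div_pow hq0, Finset.prod_range]
      refine Finset.prod_congr rfl fun m _ => ?_
      rw [if_neg (fun h' => h (Prod.ext_iff.1 h').1)]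
      field_simp
  have ha0 : ∏ i, qPoch (t * d l * a i) q n ≠ 0 :=
    Finset.prod_ne_zero_iff.2 fun i _ => qPoch_ne_zero (hda l i) n
  have hc0 : ∏ i, qPoch (t * d l * c i) q n ≠ 0 :=
    Finset.prod_ne_zero_iff.2 fun i _ => qPoch_ne_zero (hdc l i) n
  have hg : qGap 0 q n ^ Fintype.card L ≠ 0 := pow_ne_zero _ hg0
  rw [pfResidue]
  dsimp only
  rw [prod_one_sub_mul_geometric a (hda l), prod_one_sub_mul_geometric c (hdc l), hb, hdd,
    outerCoeff, upperFactor, lowerFactor]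
  simp only [div_eq_mul_inv, mul_inv, inv_inv]
  field_simp

/-- The limit of the product of all factors independent of the summation index. -/
noncomputable def outerPrefactor [DecidableEq L] (q t : ℂ) (a : I → ℂ) (b : J → ℂ) (c : K → ℂ)
    (d : L → ℂ) (l : L) : ℂ :=
  ((∏ i, qPochInf (t * d l * a i) q) * ∏ j, qPochInf (b j / d l) q) /
    ((∏ k, qPochInf (t * d l * c k) q) * ∏ l' : {l' // l' ≠ l}, qPochInf (d l' / d l) q)

theorem tendsto_upperFactor {q t : ℂ} (hq : ‖q‖ < 1) (a : I → ℂ) {c : K → ℂ} {x : ℂ}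
    (hc : ∀ k, t * x * c k ∉ OmegaQ q) :
    Tendsto (upperFactor q t a c x) atTop
      (𝓝 ((∏ i, qPochInf (t * x * a i) q) / ∏ k, qPochInf (t * x * c k) q)) :=
  Tendsto.div (tendsto_finsetProd _ fun _ _ => tendsto_qPoch hq _)
    (tendsto_finsetProd _ fun _ _ => tendsto_qPoch hq _)
    (Finset.prod_ne_zero_iff.2 fun k _ => qPochInf_ne_zero hq (hc k))

theorem tendsto_lowerFactor [DecidableEq L] {q : ℂ} (hq : ‖q‖ < 1) (b : J → ℂ) {d : L → ℂ}
    (hdd : ∀ l l', l ≠ l' → d l / d l' ∉ OmegaQ q) (l : L) :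
    Tendsto (lowerFactor q b d l) atTop (𝓝 ((∏ j, qPochInf (b j / d l) q) /
      ∏ l' : {l' // l' ≠ l}, qPochInf (d l' / d l) q)) :=
  Tendsto.div (tendsto_finsetProd _ fun _ _ => tendsto_qPoch hq _)
    (tendsto_finsetProd _ fun _ _ => tendsto_qPoch hq _)
    (Finset.prod_ne_zero_iff.2 fun l' _ => qPochInf_ne_zero hq (hdd _ _ l'.2))

/-- Passage to the limit in the sum of the residues attached to one index. -/
theorem tendsto_sum_pfResidue [DecidableEq L] {q t : ℂ} (hq0 : q ≠ 0) (hq : ‖q‖ < 1)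
    (a : I → ℂ) (b : J → ℂ) (c : K → ℂ) {d : L → ℂ}
    (hJL : Fintype.card J = Fintype.card L) (hd : ∀ l, d l ≠ 0)
    (hdd : ∀ l l', l ≠ l' → d l / d l' ∉ OmegaQ q)
    (hda : ∀ l i, t * d l * a i ∉ OmegaQ q) (hdc : ∀ l k, t * d l * c k ∉ OmegaQ q)
    (hbd : ‖∏ j, b j‖ < ‖∏ l, d l‖) (l : L) :
    Tendsto (fun N => ∑ n : Fin N, pfResidue t (fun p : I × Fin N => a p.1 * q ^ (p.2 : ℕ))
      (fun p : J × Fin N => b p.1 * q ^ (p.2 : ℕ)) (fun p : K × Fin N => c p.1 * q ^ (p.2 : ℕ))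
      (fun p : L × Fin N => d p.1 * q ^ (p.2 : ℕ)) (l, n)) atTop
      (𝓝 (outerPrefactor q t a b c d l * (∑' n, outerCoeff q t a b c d l n) *
        (qPochInf q q)⁻¹)) := by
  have hU := tendsto_upperFactor hq a (hdc l)
  have hV := tendsto_lowerFactor hq b hdd l
  have hqq : q ∉ OmegaQ q := not_mem_OmegaQ_of_norm_lt_one hq0 hq hq
  have hW := (tendsto_qPoch hq q).inv₀ (qPochInf_ne_zero hq hqq)
  -- Convergent sequences are bounded. The constants hold at all indices, so the majorant does not
  -- depend on `N`, although the factors are evaluated at `N + n`, `N - n` and `N - n - 1`.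
  obtain ⟨U, hU'⟩ := isBounded_iff_forall_norm_le.1 (Metric.isBounded_range_of_tendsto _ hU)
  obtain ⟨V, hV'⟩ := isBounded_iff_forall_norm_le.1 (Metric.isBounded_range_of_tendsto _ hV)
  obtain ⟨W, hW'⟩ := isBounded_iff_forall_norm_le.1 (Metric.isBounded_range_of_tendsto _ hW)
  -- Extension by zero makes the sums over `n < N` into series over `ℕ`; the truncated subtractions
  -- matter only when `n < N`.
  set F : ℕ → ℕ → ℂ := fun N n => if n < N then outerCoeff q t a b c d l n *
    (upperFactor q t a c (d l) (N + n) * lowerFactor q b d l (N - n) *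
      (qPoch q q (N - n - 1))⁻¹) else 0 with hF
  have hsum : ∀ N, ∑ n : Fin N, pfResidue t (fun p : I × Fin N => a p.1 * q ^ (p.2 : ℕ))
      (fun p : J × Fin N => b p.1 * q ^ (p.2 : ℕ)) (fun p : K × Fin N => c p.1 * q ^ (p.2 : ℕ))
      (fun p : L × Fin N => d p.1 * q ^ (p.2 : ℕ)) (l, n) = ∑' n, F N n := by
    intro N
    rw [tsum_eq_sum (s := range N) fun n hn => if_neg (by simpa using hn), Finset.sum_range]
    refine Finset.sum_congr rfl ?_
    rintro ⟨n, hn⟩ -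
    obtain ⟨M, rfl⟩ := Nat.exists_eq_add_of_lt hn
    rw [add_assoc] at hn
    have h := pfResidue_geometric hq0 a b c hJL hd hda hdc l n M hn
    simp only [add_assoc n M 1]
    rw [if_pos hn, Nat.add_sub_cancel_left, Nat.add_sub_cancel, add_comm (n + (M + 1)) n]
    exact h
  simp only [hsum]
  have hlim : outerPrefactor q t a b c d l * (∑' n, outerCoeff q t a b c d l n) *
      (qPochInf q q)⁻¹ = ∑' n, outerCoeff q t a b c d l n *
        (((∏ i, qPochInf (t * d l * a i) q) / ∏ k, qPochInf (t * d l * c k) q) *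
          ((∏ j, qPochInf (b j / d l) q) / ∏ l' : {l' // l' ≠ l}, qPochInf (d l' / d l) q) *
          (qPochInf q q)⁻¹) := by
    rw [tsum_mul_right, outerPrefactor, div_mul_div_comm]
    ring
  rw [hlim]
  refine tendsto_tsum_of_dominated_convergence
    (bound := fun n => ‖outerCoeff q t a b c d l n‖ * (U * V * W))
    ((summable_norm_outerCoeff hq t a b c hJL hd hbd l).mul_right _) (fun n => ?_)
    (Eventually.of_forall fun N n => ?_)
  · have h1 : Tendsto (fun N => N + n) atTop atTop := tendsto_add_atTop_nat n
    have h2 : Tendsto (fun N => N - n) atTop atTop := tendsto_sub_atTop_nat n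
    have h3 : Tendsto (fun N => N - n - 1) atTop atTop := (tendsto_sub_atTop_nat 1).comp h2
    refine ((((hU.comp h1).mul (hV.comp h2)).mul (hW.comp h3)).const_mul
      (outerCoeff q t a b c d l n)).congr' ?_
    filter_upwards [eventually_gt_atTop n] with N hN
    simp only [hF, if_pos hN, Function.comp]
  · have hU0 : 0 ≤ U := (norm_nonneg _).trans (hU' _ ⟨0, rfl⟩)
    have hV0 : 0 ≤ V := (norm_nonneg _).trans (hV' _ ⟨0, rfl⟩)
    have hW0 : 0 ≤ W := (norm_nonneg _).trans (hW' _ ⟨0, rfl⟩)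
    simp only [hF]
    split_ifs
    · rw [norm_mul, norm_mul, norm_mul]
      gcongr
      · exact hU' _ ⟨_, rfl⟩
      · exact hV' _ ⟨_, rfl⟩
      · exact hW' _ ⟨_, rfl⟩
    · rw [norm_zero]; positivity

-- The poles remain simple: different progressions are disjoint because no ratio `d l / d l'` is an
-- integer power of `q`, and a single one has no repetition because `0 < ‖q‖ < 1`.
omit [Fintype L] in
theorem injective_mul_pow {q : ℂ} (hq0 : q ≠ 0) (hq : ‖q‖ < 1) {d : L → ℂ} (hd : ∀ l, d l ≠ 0)
    (hdd : ∀ l l', l ≠ l' → d l / d l' ∉ OmegaQ q) (N : ℕ) :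
    Function.Injective fun p : L × Fin N => d p.1 * q ^ (p.2 : ℕ) := by
  rintro ⟨l, m⟩ ⟨l', m'⟩ h
  simp only at h
  have hll : l = l' := by
    by_contra hne
    refine mul_pow_ne_pow_of_not_mem_OmegaQ hq0 (hdd l l' hne)
      (by rw [inv_div]; exact hdd l' l (Ne.symm hne)) m m' ?_
    have := hd l'
    field_simp
    linear_combination h
  subst hll
  have h' := congrArg norm (mul_left_cancel₀ (hd l) h)
  rw [norm_pow, norm_pow] at h'
  have := pow_right_injective₀ (norm_pos_iff.2 hq0) hq.ne h'
  rw [Fin.ext this]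

/-- The powers of `q` cancel by equality of cardinalities, so the quotient is exactly the `N`-th
power of `∏ b / ∏ d`. This removes the residues at `0` and `∞`. -/
theorem tendsto_prod_div_prod {q : ℂ} (hq0 : q ≠ 0) {b : J → ℂ} {d : L → ℂ}
    (hJL : Fintype.card J = Fintype.card L) (hbd : ‖∏ j, b j‖ < ‖∏ l, d l‖) :
    Tendsto (fun N => (∏ p : J × Fin N, b p.1 * q ^ (p.2 : ℕ)) /
      ∏ p : L × Fin N, d p.1 * q ^ (p.2 : ℕ)) atTop (𝓝 0) := by
  have hpos : 0 < ‖∏ l, d l‖ := (norm_nonneg _).trans_lt hbd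
  have h : ‖(∏ j, b j) / ∏ l, d l‖ < 1 := by rwa [norm_div, div_lt_one hpos]
  refine (tendsto_pow_atTop_nhds_zero_of_norm_lt_one h).congr fun N => ?_
  have hQ : (∏ m : Fin N, q ^ (m : ℕ)) ^ Fintype.card L ≠ 0 :=
    pow_ne_zero _ (Finset.prod_ne_zero_iff.2 fun m _ => pow_ne_zero _ hq0)
  simp only [Fintype.prod_prod_type, Finset.prod_mul_distrib, Finset.prod_const, Finset.card_univ,
    Fintype.card_fin, hJL, Finset.prod_pow]
  rw [mul_div_mul_right _ _ hQ, div_pow]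

/-- The transformation formula with as many numerator as denominator parameters, where the
numerator parameters may vanish. -/
theorem sum_outerPrefactor_mul_tsum_eq [DecidableEq K] [DecidableEq L] {q t : ℂ} (hq0 : q ≠ 0)
    (hq : ‖q‖ < 1) (ht : t ≠ 0) (a : I → ℂ) (b : J → ℂ) {c : K → ℂ} {d : L → ℂ}
    (hIK : Fintype.card I = Fintype.card K) (hJL : Fintype.card J = Fintype.card L)
    (hc : ∀ k, c k ≠ 0) (hd : ∀ l, d l ≠ 0)
    (hcc : ∀ k k', k ≠ k' → c k / c k' ∉ OmegaQ q)
    (hdd : ∀ l l', l ≠ l' → d l / d l' ∉ OmegaQ q)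
    (hdc : ∀ l k, t * d l * c k ∉ OmegaQ q) (hda : ∀ l i, t * d l * a i ∉ OmegaQ q)
    (hcb : ∀ k j, t * c k * b j ∉ OmegaQ q)
    (hbd : ‖∏ j, b j‖ < ‖∏ l, d l‖) (hac : ‖∏ i, a i‖ < ‖∏ k, c k‖) :
    ∑ l, outerPrefactor q t a b c d l * ∑' n, outerCoeff q t a b c d l n =
      ∑ k, outerPrefactor q t b a d c k * ∑' n, outerCoeff q t b a d c k n := by
  have hcd : ∀ k l, t * c k * d l ∉ OmegaQ q := fun k l => by
    rw [mul_right_comm]; exact hdc l k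
  have h1 := tendsto_finsetSum (univ : Finset L) fun l _ =>
    tendsto_sum_pfResidue hq0 hq a b c hJL hd hdd hda hdc hbd l
  have h2 := tendsto_finsetSum (univ : Finset K) fun k _ =>
    tendsto_sum_pfResidue hq0 hq b a d hIK hc hcc hcb hcd hac k
  have h1' := h1.add (tendsto_prod_div_prod hq0 hJL hbd)
  have h2' := h2.add (tendsto_prod_div_prod hq0 hIK hac)
  have hqq : qPochInf q q ≠ 0 :=
    qPochInf_ne_zero hq (not_mem_OmegaQ_of_norm_lt_one hq0 hq hq)
  -- For each `N` the two sequences agree by the residue identity. Their limits share the factor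
  -- `(qPochInf q q)⁻¹`, which is then cancelled.
  have h := tendsto_nhds_unique (h1'.congr fun N => ?_) h2'
  · rw [add_zero, add_zero, ← Finset.sum_mul, ← Finset.sum_mul] at h
    exact mul_right_cancel₀ (inv_ne_zero hqq) h
  · rw [← Fintype.sum_prod_type', ← Fintype.sum_prod_type']
    refine sum_pfResidue_add_eq ht (by simp [hIK]) (by simp [hJL]) _ _
      (fun p => mul_ne_zero (hc _) (pow_ne_zero _ hq0))
      (fun p => mul_ne_zero (hd _) (pow_ne_zero _ hq0))
      (injective_mul_pow hq0 hq hc hcc N) (injective_mul_pow hq0 hq hd hdd N) ?_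
    rintro ⟨l, m⟩ ⟨k, m'⟩ h
    refine hdc l k ⟨m + m', eq_inv_of_mul_eq_one_left ?_⟩
    rw [← h, pow_add]
    ring

end

/-! ### Padding with zeros and translation into basic hypergeometric series. -/

theorem qPoch_zero_left (q : ℂ) (n : ℕ) : qPoch 0 q n = 1 := by simp [qPoch]

theorem qPochInf_zero_left (q : ℂ) : qPochInf 0 q = 1 := by simp [qPochInf]

theorem zero_not_mem_OmegaQ {q : ℂ} (hq0 : q ≠ 0) : (0 : ℂ) ∉ OmegaQ q := by
  rintro ⟨k, hk⟩
  exact inv_ne_zero (pow_ne_zero k hq0) hk.symm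

theorem prod_padZero {A : ℕ} (a : Fin A → ℂ) (p : ℕ) (f : ℂ → ℂ) :
    ∏ i, f (padZero a p i) = (∏ i, f (a i)) * f 0 ^ p := by
  simp [padZero, Fintype.prod_sum_type]

theorem forall_padZero_not_mem_OmegaQ {q x : ℂ} (hq0 : q ≠ 0) {A : ℕ} {a : Fin A → ℂ} (p : ℕ)
    (h : ∀ i, x * a i ∉ OmegaQ q) (i : Fin A ⊕ Fin p) : x * padZero a p i ∉ OmegaQ q := by
  rcases i with i | i
  · exact h i
  · simpa [padZero] using zero_not_mem_OmegaQ hq0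

/-- If `A < C`, at least one zero is adjoined and the product on the left vanishes. The two
alternatives of the convergence hypothesis thus become one inequality. -/
theorem norm_prod_padZero_lt {A C : ℕ} {a : Fin A → ℂ} {c : Fin C → ℂ} (hc : ∀ k, c k ≠ 0)
    (h : A < C ∨ (A = C ∧ ‖∏ i, a i‖ < ‖∏ k, c k‖)) :
    ‖∏ i, padZero a (C - A) i‖ < ‖∏ k, c k‖ := by
  have hp := prod_padZero a (C - A) id
  simp only [id] at hp
  rw [hp]
  rcases h with h | ⟨rfl, h⟩
  · rw [zero_pow (Nat.sub_ne_zero_of_lt h), mul_zero, norm_zero]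
    exact norm_pos_iff.2 (Finset.prod_ne_zero_iff.2 fun k _ => hc k)
  · simpa using h

/-- The terms of the series in the transformation formula. -/
theorem phiVBRTerm_eq_outerCoeff {A B C D : ℕ} {q : ℂ} (t : ℂ)
    (a : Fin A → ℂ) {b : Fin B → ℂ} (c : Fin C → ℂ) {d : Fin D → ℂ} (hAC : A ≤ C) (hBD : B ≤ D)
    (hb : ∀ j, b j ≠ 0) (hd : ∀ l, d l ≠ 0) (k : Fin D) (n : ℕ) :
    phiVBRTerm ((C : ℤ) - A)
        (Sum.elim (fun j : Fin C => t * d k * c j) (fun j : Fin B => q * d k / b j))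
        (Sum.elim (fun i : Fin A => t * d k * a i)
          (fun l : {l : Fin D // l ≠ k} => q * d k / d l))
        q ((q * d k) ^ (D - B) * ((∏ j, b j) / ∏ l, d l)) n =
      outerCoeff q t (padZero a (C - A)) (padZero b (D - B)) c d k n := by
  obtain ⟨e, rfl⟩ := Nat.exists_eq_add_of_le hBD
  obtain ⟨p, rfl⟩ := Nat.exists_eq_add_of_le hAC
  have hk := hd k
  have hp : (((A + p : ℕ) : ℤ) - A).toNat = p := by omega
  have hp' : (-(((A + p : ℕ) : ℤ) - A)).toNat = 0 := by omega
  have hcard : Fintype.card {l : Fin (B + e) // l ≠ k} = B + e - 1 := by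
    simp
  have hpos : 0 < B + e := k.pos
  -- Here `s = A + (B + e - 1) + p` and `r + 1 = A + p + B`, so `s - r = e`: the `p` adjoined lower
  -- zeros change no product and serve only to balance this exponent. The subtraction in `B + e - 1`
  -- is genuine by `hpos`.
  have hexp : ((Fintype.card ((Fin A ⊕ {l : Fin (B + e) // l ≠ k}) ⊕ Fin p) : ℕ) : ℤ) -
      ((Fintype.card ((Fin (A + p) ⊕ Fin B) ⊕ Fin 0) : ℕ) - 1) = (e : ℕ) := by
    simp only [Fintype.card_sum, Fintype.card_fin, hcard]
    omega
  have hgb : ∏ j, qGap (b j / d k) q n =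
      ((-(d k)⁻¹) ^ B * ∏ j, b j) ^ n * ∏ j, qPoch (q * d k / b j) q n := by
    have h : (-(d k)⁻¹) ^ B * ∏ j, b j = ∏ j, -(b j / d k) := by
      rw [← Fin.prod_const, ← Finset.prod_mul_distrib]
      exact Finset.prod_congr rfl fun j _ => by rw [div_eq_mul_inv]; ring
    rw [h, ← Finset.prod_pow, ← Finset.prod_mul_distrib]
    refine Finset.prod_congr rfl fun j _ => ?_
    rw [qGap_eq (div_ne_zero (hb j) hk), div_div_eq_mul_div]
  have hgd : ∏ l, qGap (d l / d k) q n =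
      ((-(d k)⁻¹) ^ (B + e) * ∏ l, d l) ^ n *
        (qPoch q q n * ∏ l : {l // l ≠ k}, qPoch (q * d k / d l) q n) := by
    have h : (-(d k)⁻¹) ^ (B + e) * ∏ l, d l = ∏ l, -(d l / d k) := by
      rw [← Fin.prod_const, ← Finset.prod_mul_distrib]
      exact Finset.prod_congr rfl fun j _ => by rw [div_eq_mul_inv]; ring
    have h' : qPoch q q n = qPoch (q * d k / d k) q n := by rw [mul_div_cancel_right₀ _ hk]
    rw [h, h', ← Fintype.prod_eq_mul_prod_subtype_ne (fun l => qPoch (q * d k / d l) q n) k,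
      ← Finset.prod_pow, ← Finset.prod_mul_distrib]
    refine Finset.prod_congr rfl fun j _ => ?_
    rw [qGap_eq (div_ne_zero (hd j) hk), div_div_eq_mul_div]
  -- Everything outside the `q`-shifted factorials is collected here. In terms of `w = -(d k)⁻¹`
  -- both sides are monomials, and the sign `(-1) ^ (n * e)` appears twice on the left.
  have hscalar : ((-1) ^ n * q ^ n.choose 2) ^ e *
      ((q * d k) ^ e * ((∏ j, b j) / ∏ l, d l)) ^ n =
      ((-(d k)⁻¹) ^ B * ∏ j, b j) ^ n * (q ^ n.choose 2 * q ^ n) ^ e /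
        ((-(d k)⁻¹) ^ (B + e) * ∏ l, d l) ^ n := by
    have hw : -(d k)⁻¹ ≠ 0 := neg_ne_zero.2 (inv_ne_zero hk)
    have hdk : q * d k = -(q * (-(d k)⁻¹)⁻¹) := by rw [inv_neg, inv_inv]; ring
    have hδ : ∏ l, d l ≠ 0 := Finset.prod_ne_zero_iff.2 fun l _ => hd l
    rw [hdk]
    generalize -(d k)⁻¹ = w at hw
    generalize ∏ l, d l = δ at hδ
    generalize q ^ n.choose 2 = Q
    have h1 : ((-1 : ℂ) ^ n) ^ e * ((-1) ^ e) ^ n = 1 := by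
      rw [← pow_mul, ← pow_mul, mul_comm e n, ← mul_pow]
      norm_num
    have h2 : (-(q * w⁻¹)) ^ e = (-1) ^ e * q ^ e * (w ^ e)⁻¹ := by
      rw [neg_pow, mul_pow, inv_pow, mul_assoc]
    rw [h2, mul_pow _ Q, mul_pow _ _ n, mul_pow _ _ n, mul_pow _ _ n, mul_pow _ _ n, mul_pow _ _ n,
      mul_pow Q, pow_add w, mul_pow _ _ n, div_pow, inv_pow, pow_right_comm q n e]
    calc ((-1 : ℂ) ^ n) ^ e * Q ^ e * (((-1) ^ e) ^ n * (q ^ e) ^ n * ((w ^ e) ^ n)⁻¹ *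
          ((∏ j, b j) ^ n / δ ^ n))
        = (((-1 : ℂ) ^ n) ^ e * ((-1) ^ e) ^ n) * (Q ^ e * ((q ^ e) ^ n * ((w ^ e) ^ n)⁻¹ *
          ((∏ j, b j) ^ n / δ ^ n))) := by ring
      _ = _ := by
        rw [h1, one_mul]
        field_simp
  have hup : ∏ k', qPoch (t * d k * padZero a p k') q n = ∏ i, qPoch (t * d k * a i) q n := by
    rw [prod_padZero a p (fun y => qPoch (t * d k * y) q n), mul_zero, qPoch_zero_left, one_pow,
      mul_one]
  have hlow : ∏ j, qGap (padZero b e j / d k) q n =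
      (∏ j, qGap (b j / d k) q n) * (q ^ n.choose 2 * q ^ n) ^ e := by
    rw [prod_padZero b e (fun y => qGap (y / d k) q n), zero_div, qGap_zero_eq]
  rw [phiVBRTerm, hp, hp', phiTerm, hexp, zpow_natCast, Nat.add_sub_cancel_left,
    Nat.add_sub_cancel_left, outerCoeff, hup, hlow, hgb, hgd]
  simp only [padZero, Fintype.prod_sum_type, Sum.elim_inl, Sum.elim_inr, qPoch_zero_left,
    Finset.prod_const_one, mul_one]
  rw [mul_assoc, hscalar]
  generalize ((-(d k)⁻¹) ^ B * ∏ j, b j) ^ n = x1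
  generalize ((-(d k)⁻¹) ^ (B + e) * ∏ l, d l) ^ n = x2
  rw [div_mul_div_comm]
  congr 1 <;> ring

theorem outerPrefactor_padZero {A B C D : ℕ} (q t : ℂ) (a : Fin A → ℂ) (b : Fin B → ℂ)
    (c : Fin C → ℂ) (d : Fin D → ℂ) (p r : ℕ) (k : Fin D) :
    outerPrefactor q t (padZero a p) (padZero b r) c d k =
      ((∏ i, qPochInf (t * d k * a i) q) * ∏ j, qPochInf (b j / d k) q) /
        ((∏ j, qPochInf (t * d k * c j) q) *
          ∏ l : {l : Fin D // l ≠ k}, qPochInf (d l / d k) q) := by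
  rw [outerPrefactor, prod_padZero a p (fun y => qPochInf (t * d k * y) q),
    prod_padZero b r (fun y => qPochInf (y / d k) q), mul_zero, zero_div, qPochInf_zero_left,
    one_pow, one_pow, mul_one, mul_one]

theorem le_of_lt_or_eq_and {A C : ℕ} {P : Prop} (h : A < C ∨ (A = C ∧ P)) : A ≤ C :=
  h.elim le_of_lt fun h => h.1.le

theorem summable_phiVBRTerm {A B C D : ℕ} {q : ℂ} (hq : ‖q‖ < 1) (t : ℂ) (a : Fin A → ℂ)
    {b : Fin B → ℂ} (c : Fin C → ℂ) {d : Fin D → ℂ} (hb : ∀ j, b j ≠ 0) (hd : ∀ l, d l ≠ 0)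
    (hbd : B < D ∨ (B = D ∧ ‖∏ j, b j‖ < ‖∏ l, d l‖)) (hAC : A ≤ C) (k : Fin D) :
    Summable (phiVBRTerm ((C : ℤ) - A)
      (Sum.elim (fun j : Fin C => t * d k * c j) (fun j : Fin B => q * d k / b j))
      (Sum.elim (fun i : Fin A => t * d k * a i)
        (fun l : {l : Fin D // l ≠ k} => q * d k / d l))
      q ((q * d k) ^ (D - B) * ((∏ j, b j) / ∏ l, d l))) := by
  have hBD := le_of_lt_or_eq_and hbd
  have hcard : Fintype.card (Fin B ⊕ Fin (D - B)) = Fintype.card (Fin D) := by simp [hBD]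
  exact (summable_congr fun n => phiVBRTerm_eq_outerCoeff t a c hAC hBD hb hd k n).2
    (summable_norm_outerCoeff hq t _ _ c hcard hd (norm_prod_padZero_lt hd hbd) k).of_norm

theorem phiVBR_eq_tsum_outerCoeff {A B C D : ℕ} {q : ℂ} (t : ℂ)
    (a : Fin A → ℂ) {b : Fin B → ℂ} (c : Fin C → ℂ) {d : Fin D → ℂ} (hAC : A ≤ C) (hBD : B ≤ D)
    (hb : ∀ j, b j ≠ 0) (hd : ∀ l, d l ≠ 0) (k : Fin D) :
    phiVBR ((C : ℤ) - A)
        (Sum.elim (fun j : Fin C => t * d k * c j) (fun j : Fin B => q * d k / b j))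
        (Sum.elim (fun i : Fin A => t * d k * a i)
          (fun l : {l : Fin D // l ≠ k} => q * d k / d l))
        q ((q * d k) ^ (D - B) * ((∏ j, b j) / ∏ l, d l)) =
      ∑' n, outerCoeff q t (padZero a (C - A)) (padZero b (D - B)) c d k n :=
  tsum_congr fun n => phiVBRTerm_eq_outerCoeff t a c hAC hBD hb hd k n

/-- The transformation formula for general families of parameters. -/
theorem sum_phiVBR_eq_sum_phiVBR {A B C D : ℕ} {q t : ℂ} (hq0 : q ≠ 0) (hq1 : ‖q‖ < 1)
    (ht : t ≠ 0) {a : Fin A → ℂ} {b : Fin B → ℂ} {c : Fin C → ℂ} {d : Fin D → ℂ}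
    (ha : ∀ i, a i ≠ 0) (hb : ∀ j, b j ≠ 0) (hc : ∀ k, c k ≠ 0) (hd : ∀ l, d l ≠ 0)
    (hcc : ∀ k k', k ≠ k' → c k / c k' ∉ OmegaQ q)
    (hdd : ∀ l l', l ≠ l' → d l / d l' ∉ OmegaQ q)
    (hdc : ∀ l k, t * d l * c k ∉ OmegaQ q) (hda : ∀ l i, t * d l * a i ∉ OmegaQ q)
    (hcb : ∀ k j, t * c k * b j ∉ OmegaQ q)
    (hbd : B < D ∨ (B = D ∧ ‖∏ j, b j‖ < ‖∏ l, d l‖))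
    (hac : A < C ∨ (A = C ∧ ‖∏ i, a i‖ < ‖∏ k, c k‖)) :
    ∑ k : Fin D,
        ((∏ i, qPochInf (t * d k * a i) q) * ∏ j, qPochInf (b j / d k) q) /
          ((∏ j, qPochInf (t * d k * c j) q) *
            ∏ l : {l : Fin D // l ≠ k}, qPochInf (d l / d k) q) *
        phiVBR ((C : ℤ) - A)
          (Sum.elim (fun j : Fin C => t * d k * c j) (fun j : Fin B => q * d k / b j))
          (Sum.elim (fun i : Fin A => t * d k * a i)
            (fun l : {l : Fin D // l ≠ k} => q * d k / d l))
          q ((q * d k) ^ (D - B) * ((∏ j, b j) / ∏ l, d l)) =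
      ∑ k : Fin C,
        ((∏ j, qPochInf (t * c k * b j) q) * ∏ i, qPochInf (a i / c k) q) /
          ((∏ l, qPochInf (t * c k * d l) q) *
            ∏ l : {l : Fin C // l ≠ k}, qPochInf (c l / c k) q) *
        phiVBR ((D : ℤ) - B)
          (Sum.elim (fun l : Fin D => t * c k * d l) (fun i : Fin A => q * c k / a i))
          (Sum.elim (fun j : Fin B => t * c k * b j)
            (fun l : {l : Fin C // l ≠ k} => q * c k / c l))
          q ((q * c k) ^ (C - A) * ((∏ i, a i) / ∏ l, c l)) := by
  have hBD := le_of_lt_or_eq_and hbd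
  have hAC := le_of_lt_or_eq_and hac
  simp only [phiVBR_eq_tsum_outerCoeff t a c hAC hBD hb hd,
    phiVBR_eq_tsum_outerCoeff t b d hBD hAC ha hc,
    ← outerPrefactor_padZero q t a b c d (C - A) (D - B),
    ← outerPrefactor_padZero q t b a d c (D - B) (C - A)]
  exact sum_outerPrefactor_mul_tsum_eq hq0 hq1 ht (padZero a (C - A)) (padZero b (D - B))
    (by simp [hAC]) (by simp [hBD]) hc hd hcc hdd hdc
    (fun l => forall_padZero_not_mem_OmegaQ hq0 _ (hda l))
    (fun k => forall_padZero_not_mem_OmegaQ hq0 _ (hcb k))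
    (norm_prod_padZero_lt hd hbd) (norm_prod_padZero_lt hc hac)

/-! ### The case of two pairs of `₄φ₃` series. -/

theorem prod_subtype_ne_zero_fin_two (f : Fin 2 → ℂ) : ∏ l : {l : Fin 2 // l ≠ 0}, f l = f 1 := by
  have : (univ : Finset {l : Fin 2 // l ≠ 0}) = {⟨1, by decide⟩} := by decide
  rw [this, Finset.prod_singleton]

theorem prod_subtype_ne_one_fin_two (f : Fin 2 → ℂ) : ∏ l : {l : Fin 2 // l ≠ 1}, f l = f 0 := by
  have : (univ : Finset {l : Fin 2 // l ≠ 1}) = {⟨0, by decide⟩} := by decide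
  rw [this, Finset.prod_singleton]

/-- The hypothesis `hk` encodes that `k'` is the only index other than `k`, so that `k = 0` and `k =
1` are treated together. No zeros are adjoined here. -/
theorem phiVBRTerm_fin_two (q t z : ℂ) (a b c d : Fin 2 → ℂ) {k k' : Fin 2}
    (hk : ∀ f : Fin 2 → ℂ, ∏ l : {l : Fin 2 // l ≠ k}, f l = f k') :
    phiVBRTerm (((2 : ℕ) : ℤ) - (2 : ℕ))
        (Sum.elim (fun j : Fin 2 => t * d k * c j) (fun j : Fin 2 => q * d k / b j))
        (Sum.elim (fun i : Fin 2 => t * d k * a i)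
          (fun l : {l : Fin 2 // l ≠ k} => q * d k / d l))
        q ((q * d k) ^ (2 - 2) * z) =
      phiTerm ![d k * t * c 0, d k * t * c 1, q * d k / b 0, q * d k / b 1]
        ![d k * t * a 0, d k * t * a 1, q * d k / d k'] q z := by
  funext n
  have hcard : Fintype.card {l : Fin 2 // l ≠ k} = 1 := by simp
  have h := hk fun l => qPoch (q * d k / d l) q n
  have h0 : (((2 : ℕ) : ℤ) - (2 : ℕ)).toNat = 0 := rfl
  have h0' : (-(((2 : ℕ) : ℤ) - (2 : ℕ))).toNat = 0 := rfl
  rw [phiVBRTerm, h0, h0', phiTerm, phiTerm]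
  simp only [padZero, Fintype.prod_sum_type, Sum.elim_inl, Sum.elim_inr, h, Fin.prod_univ_two,
    Fin.prod_univ_three, Fin.prod_univ_four, Fintype.card_sum, Fintype.card_fin, hcard,
    Finset.univ_eq_empty, Finset.prod_empty, Matrix.cons_val, mul_comm t, Nat.sub_self, pow_zero,
    one_mul, mul_one]
  norm_num [mul_assoc]

theorem phiVBR_fin_two (q t z : ℂ) (a b c d : Fin 2 → ℂ) {k k' : Fin 2}
    (hk : ∀ f : Fin 2 → ℂ, ∏ l : {l : Fin 2 // l ≠ k}, f l = f k') :
    phiVBR (((2 : ℕ) : ℤ) - (2 : ℕ))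
        (Sum.elim (fun j : Fin 2 => t * d k * c j) (fun j : Fin 2 => q * d k / b j))
        (Sum.elim (fun i : Fin 2 => t * d k * a i)
          (fun l : {l : Fin 2 // l ≠ k} => q * d k / d l))
        q ((q * d k) ^ (2 - 2) * z) =
      phi ![d k * t * c 0, d k * t * c 1, q * d k / b 0, q * d k / b 1]
        ![d k * t * a 0, d k * t * a 1, q * d k / d k'] q z :=
  tsum_congr fun n => congrFun (phiVBRTerm_fin_two q t z a b c d hk) n

end

theorem mainTheorem4 (q t : ℂ) (hq0 : q ≠ 0) (hq1 : ‖q‖ < 1) (ht : t ≠ 0) :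
    -- the general transformation
    (∀ (A B C D : ℕ) (a : Fin A → ℂ) (b : Fin B → ℂ) (c : Fin C → ℂ) (d : Fin D → ℂ),
      (∀ i, a i ≠ 0) → (∀ j, b j ≠ 0) → (∀ k, c k ≠ 0) → (∀ l, d l ≠ 0) →
      (∀ k k', k ≠ k' → c k / c k' ∉ OmegaQ q) →
      (∀ l l', l ≠ l' → d l / d l' ∉ OmegaQ q) →
      (∀ l k, t * d l * c k ∉ OmegaQ q) →
      (∀ l i, t * d l * a i ∉ OmegaQ q) →
      (∀ k j, t * c k * b j ∉ OmegaQ q) →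
      (B < D ∨ (B = D ∧ ‖∏ j, b j‖ < ‖∏ l, d l‖)) →
      (A < C ∨ (A = C ∧ ‖∏ i, a i‖ < ‖∏ k, c k‖)) →
      (∀ k : Fin D, Summable (phiVBRTerm ((C : ℤ) - A)
          (Sum.elim (fun j : Fin C => t * d k * c j) (fun j : Fin B => q * d k / b j))
          (Sum.elim (fun i : Fin A => t * d k * a i)
            (fun l : {l : Fin D // l ≠ k} => q * d k / d l))
          q ((q * d k) ^ (D - B) * ((∏ j, b j) / ∏ l, d l)))) ∧
      (∀ k : Fin C, Summable (phiVBRTerm ((D : ℤ) - B)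
          (Sum.elim (fun l : Fin D => t * c k * d l) (fun i : Fin A => q * c k / a i))
          (Sum.elim (fun j : Fin B => t * c k * b j)
            (fun l : {l : Fin C // l ≠ k} => q * c k / c l))
          q ((q * c k) ^ (C - A) * ((∏ i, a i) / ∏ l, c l)))) ∧
      (∑ k : Fin D,
        ((∏ i, qPochInf (t * d k * a i) q) * ∏ j, qPochInf (b j / d k) q) /
          ((∏ j, qPochInf (t * d k * c j) q) *
            ∏ l : {l : Fin D // l ≠ k}, qPochInf (d l / d k) q) *
        phiVBR ((C : ℤ) - A)
          (Sum.elim (fun j : Fin C => t * d k * c j) (fun j : Fin B => q * d k / b j))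
          (Sum.elim (fun i : Fin A => t * d k * a i)
            (fun l : {l : Fin D // l ≠ k} => q * d k / d l))
          q ((q * d k) ^ (D - B) * ((∏ j, b j) / ∏ l, d l))) =
      ∑ k : Fin C,
        ((∏ j, qPochInf (t * c k * b j) q) * ∏ i, qPochInf (a i / c k) q) /
          ((∏ l, qPochInf (t * c k * d l) q) *
            ∏ l : {l : Fin C // l ≠ k}, qPochInf (c l / c k) q) *
        phiVBR ((D : ℤ) - B)
          (Sum.elim (fun l : Fin D => t * c k * d l) (fun i : Fin A => q * c k / a i))
          (Sum.elim (fun j : Fin B => t * c k * b j)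
            (fun l : {l : Fin C // l ≠ k} => q * c k / c l))
          q ((q * c k) ^ (C - A) * ((∏ i, a i) / ∏ l, c l))) ∧
    -- the case of two pairs of `₄φ₃`'s
    (∀ a b c d e f g h : ℂ,
      a ≠ 0 → b ≠ 0 → c ≠ 0 → d ≠ 0 → e ≠ 0 → f ≠ 0 → g ≠ 0 → h ≠ 0 →
      ‖a * b‖ < ‖e * f‖ → ‖c * d‖ < ‖g * h‖ →
      e / f ∉ OmegaQ q → f / e ∉ OmegaQ q → g / h ∉ OmegaQ q → h / g ∉ OmegaQ q →
      (∀ x ∈ ({e, f} : Set ℂ), ∀ y ∈ ({g, h, c, d} : Set ℂ), x * t * y ∉ OmegaQ q) →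
      (∀ x ∈ ({g, h} : Set ℂ), ∀ y ∈ ({a, b} : Set ℂ), x * t * y ∉ OmegaQ q) →
      Summable (phiTerm ![e * t * g, e * t * h, q * e / a, q * e / b]
        ![e * t * c, e * t * d, q * e / f] q (a * b / (e * f))) ∧
      Summable (phiTerm ![f * t * g, f * t * h, q * f / a, q * f / b]
        ![f * t * c, f * t * d, q * f / e] q (a * b / (f * e))) ∧
      Summable (phiTerm ![g * t * e, g * t * f, q * g / c, q * g / d]
        ![g * t * a, g * t * b, q * g / h] q (c * d / (g * h))) ∧
      Summable (phiTerm ![h * t * e, h * t * f, q * h / c, q * h / d]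
        ![h * t * a, h * t * b, q * h / g] q (c * d / (h * g))) ∧
      qPochInf (e * t * c) q * qPochInf (e * t * d) q * qPochInf (a / e) q * qPochInf (b / e) q /
          (qPochInf (e * t * g) q * qPochInf (e * t * h) q * qPochInf (f / e) q) *
          phi ![e * t * g, e * t * h, q * e / a, q * e / b]
            ![e * t * c, e * t * d, q * e / f] q (a * b / (e * f)) +
        qPochInf (f * t * c) q * qPochInf (f * t * d) q * qPochInf (a / f) q * qPochInf (b / f) q /
          (qPochInf (f * t * g) q * qPochInf (f * t * h) q * qPochInf (e / f) q) *
          phi ![f * t * g, f * t * h, q * f / a, q * f / b]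
            ![f * t * c, f * t * d, q * f / e] q (a * b / (f * e)) =
      qPochInf (g * t * a) q * qPochInf (g * t * b) q * qPochInf (c / g) q * qPochInf (d / g) q /
          (qPochInf (g * t * e) q * qPochInf (g * t * f) q * qPochInf (h / g) q) *
          phi ![g * t * e, g * t * f, q * g / c, q * g / d]
            ![g * t * a, g * t * b, q * g / h] q (c * d / (g * h)) +
        qPochInf (h * t * a) q * qPochInf (h * t * b) q * qPochInf (c / h) q * qPochInf (d / h) q /
          (qPochInf (h * t * e) q * qPochInf (h * t * f) q * qPochInf (g / h) q) *
          phi ![h * t * e, h * t * f, q * h / c, q * h / d]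
            ![h * t * a, h * t * b, q * h / g] q (c * d / (h * g))) := by
  refine ⟨fun A B C D a b c d ha hb hc hd hcc hdd hdc hda hcb hbd hac => ⟨fun k => ?_, fun k => ?_,
    sum_phiVBR_eq_sum_phiVBR hq0 hq1 ht ha hb hc hd hcc hdd hdc hda hcb hbd hac⟩, ?_⟩
  · exact summable_phiVBRTerm hq1 t a c hb hd hbd (le_of_lt_or_eq_and hac) k
  · exact summable_phiVBRTerm hq1 t b d ha hc hac (le_of_lt_or_eq_and hbd) k
  intro a b c d e f g h ha hb hc hd he hf hg hh hab hcd hef hfe hgh hhg hxy hxy'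
  -- The pairs `(a, b)`, `(c, d)`, `(e, f)`, `(g, h)` take the roles of the families `b`, `a`, `d`,
  -- `c` of the general formula, in this order.
  have hb' : ∀ j, ![a, b] j ≠ 0 := by simp [Fin.forall_fin_two, ha, hb]
  have ha' : ∀ j, ![c, d] j ≠ 0 := by simp [Fin.forall_fin_two, hc, hd]
  have hd' : ∀ j, ![e, f] j ≠ 0 := by simp [Fin.forall_fin_two, he, hf]
  have hc' : ∀ j, ![g, h] j ≠ 0 := by simp [Fin.forall_fin_two, hg, hh]
  have hcc : ∀ k k', k ≠ k' → ![g, h] k / ![g, h] k' ∉ OmegaQ q := by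
    simp [Fin.forall_fin_two, hgh, hhg]
  have hdd : ∀ k k', k ≠ k' → ![e, f] k / ![e, f] k' ∉ OmegaQ q := by
    simp [Fin.forall_fin_two, hef, hfe]
  have hdc : ∀ l k, t * ![e, f] l * ![g, h] k ∉ OmegaQ q := by
    simp only [mul_comm t]
    simp [Fin.forall_fin_two] at hxy ⊢
    tauto
  have hda : ∀ l k, t * ![e, f] l * ![c, d] k ∉ OmegaQ q := by
    simp only [mul_comm t]
    simp [Fin.forall_fin_two] at hxy ⊢
    tauto
  have hcb : ∀ l k, t * ![g, h] l * ![a, b] k ∉ OmegaQ q := by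
    simp only [mul_comm t]
    simp [Fin.forall_fin_two] at hxy' ⊢
    tauto
  have hbd : 2 < 2 ∨ (2 = 2 ∧ ‖∏ j, ![a, b] j‖ < ‖∏ l, ![e, f] l‖) :=
    Or.inr ⟨rfl, by simpa using hab⟩
  have hac : 2 < 2 ∨ (2 = 2 ∧ ‖∏ j, ![c, d] j‖ < ‖∏ l, ![g, h] l‖) :=
    Or.inr ⟨rfl, by simpa using hcd⟩
  have s1 := summable_phiVBRTerm hq1 t ![c, d] ![g, h] hb' hd' hbd le_rfl
  have s2 := summable_phiVBRTerm hq1 t ![a, b] ![e, f] ha' hc' hac le_rfl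
  have s10 := s1 0
  have s11 := s1 1
  have s20 := s2 0
  have s21 := s2 1
  have key := sum_phiVBR_eq_sum_phiVBR hq0 hq1 ht ha' hb' hc' hd' hcc hdd hdc hda hcb hbd hac
  rw [phiVBRTerm_fin_two q t _ _ _ _ _ prod_subtype_ne_zero_fin_two] at s10 s20
  rw [phiVBRTerm_fin_two q t _ _ _ _ _ prod_subtype_ne_one_fin_two] at s11 s21
  rw [Fin.sum_univ_two, Fin.sum_univ_two,
    phiVBR_fin_two q t _ _ _ _ _ prod_subtype_ne_zero_fin_two,
    phiVBR_fin_two q t _ _ _ _ _ prod_subtype_ne_one_fin_two,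
    phiVBR_fin_two q t _ _ _ _ _ prod_subtype_ne_zero_fin_two,
    phiVBR_fin_two q t _ _ _ _ _ prod_subtype_ne_one_fin_two,
    prod_subtype_ne_zero_fin_two (fun l => qPochInf (![e, f] l / ![e, f] 0) q),
    prod_subtype_ne_one_fin_two (fun l => qPochInf (![e, f] l / ![e, f] 1) q),
    prod_subtype_ne_zero_fin_two (fun l => qPochInf (![g, h] l / ![g, h] 0) q),
    prod_subtype_ne_one_fin_two (fun l => qPochInf (![g, h] l / ![g, h] 1) q)] at key
  simp only [Fin.prod_univ_two, Matrix.cons_val_zero, Matrix.cons_val_one] at s10 s11 s20 s21 key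
  -- Interchanging the letters reverses the products in the arguments, whereas the general formula
  -- has the same product for both indices.
  rw [mul_comm f e, mul_comm h g]
  refine ⟨s10, s11, s20, s21, ?_⟩
  simp only [mul_comm t, ← mul_assoc] at key
  exact key
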